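/- Let $n\ge 2$, $I=(0,1)$ and $\bar I=[0,1]$. For an immersed curve $\gamma\in W^{2,2}(I;\mathbf{R}^n)$ put $ds=|\partial_x\gamma|\,dx$, $\partial_s=|\partial_x\gamma|^{-1}\partial_x$, $\kappa=\gamma_{ss}$, $\nabla_sX=X_s-\langle X_s,\gamma_s\rangle\gamma_s$, and let $L[\gamma]=\int_I ds$ be its length and $B[\gamma]=\int_I|\kappa|^2\,ds$ its bending energy. Call $\gamma$ an elastica if it is a critical point of $B$ among curves of fixed length, that is, $\frac{d}{d\varepsilon}\big|_{\varepsilon=0}B[\gamma+\eta_\varepsilon]=0$ for every family $\eta_\varepsilon(x)$ that is smooth in $(\varepsilon,x)$, is supported in $x$ in a compact subset of $I$ independent of $\varepsilon$, and satisfies $\eta_0=0$ and $L[\gamma+\eta_\varepsilon]=L[\gamma]$ for all small $\varepsilon$. For $\lambda\in\mathbf{R}$, call $\gamma$ a $\lambda$-elastica if it is an elastica of class $C^4(\bar I)$ and $$2\nabla_s^2\kappa+|\kappa|^2\kappa-\lambda\kappa=0\quad\text{on }\bar I .$$ Let $\{\gamma_j\}_{j}\subset C^\omega(\bar I;\mathbf{R}^n)$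 be a sequence such that each $\gamma_j$ is a $\lambda_j$-elastica, where $\lambda_j\in\mathbf{R}$, and has constant speed, $|\partial_x\gamma_j|\equiv L[\gamma_j]$. Suppose that there is $C>0$ such that $B[\gamma_j]\le C$ and $\frac1C\le L[\gamma_j]\le C$ for all $j$, that $\gamma_j\to\gamma_\infty$ in $C^1(\bar I;\mathbf{R}^n)$ for some curve $\gamma_\infty$, and that $\sup_j|\lambda_j|<\infty$. Then $\gamma_j\to\gamma_\infty$ smoothly, that is, $\gamma_\infty\in C^\infty(\bar I;\mathbf{R}^n)$ and $\|\gamma_j-\gamma_\infty\|_{C^m(\bar I;\mathbf{R}^n)}\to0$ for every $m\ge0$, and $\gamma_\infty$ is an elastica, in fact a $\lambda_\infty$-elastica for some $\lambda_\infty\in\mathbf{R}$. -/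

import Mathlib

open Set Filter Topology MeasureTheory
open scoped ContDiff

namespace ElasticCurve

/-- The closed parameter interval `[0, 1]`, the closure of `I = (0, 1)`. -/
abbrev J : Set ℝ := Icc (0 : ℝ) 1

/-- The ambient Euclidean space `ℝⁿ`. -/
abbrev Space (n : ℕ) : Type := EuclideanSpace ℝ (Fin n)

/-- The parameter derivative `∂ₓ X` on `[0, 1]` (one-sided at the endpoints). A curve is a function
on `ℝ` of which only the values on `[0, 1]` matter. -/
noncomputable def dx {n : ℕ} (X : ℝ → Space n) : ℝ → Space n :=
  fun x => derivWithin X J x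

/-- The arclength derivative `∂ₛ X = |∂ₓ γ|⁻¹ ∂ₓ X` along the curve `γ`. -/
noncomputable def ds {n : ℕ} (γ X : ℝ → Space n) : ℝ → Space n :=
  fun x => ‖dx γ x‖⁻¹ • dx X x

/-- The unit tangent `γₛ`. -/
noncomputable def tangent {n : ℕ} (γ : ℝ → Space n) : ℝ → Space n :=
  ds γ γ

/-- The curvature vector `κ = γₛₛ`. -/
noncomputable def curvature {n : ℕ} (γ : ℝ → Space n) : ℝ → Space n :=
  ds γ (ds γ γ)

/-- The normal derivative `∇ₛ X = Xₛ - ⟨Xₛ, γₛ⟩ γₛ`. -/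
noncomputable def normalDeriv {n : ℕ} (γ X : ℝ → Space n) : ℝ → Space n :=
  fun x => ds γ X x - inner ℝ (ds γ X x) (tangent γ x) • tangent γ x

/-- The length `L[γ] = ∫ ds`, where `ds = |∂ₓ γ| dx`. -/
noncomputable def length {n : ℕ} (γ : ℝ → Space n) : ℝ :=
  ∫ x in (0 : ℝ)..1, ‖dx γ x‖

/-- The bending energy `B[γ] = ∫ |κ|² ds`. -/
noncomputable def bending {n : ℕ} (γ : ℝ → Space n) : ℝ :=
  ∫ x in (0 : ℝ)..1, ‖curvature γ x‖ ^ 2 * ‖dx γ x‖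

/-- The curve is immersed: `∂ₓ γ` vanishes nowhere on `[0, 1]`. -/
def Immersed {n : ℕ} (γ : ℝ → Space n) : Prop :=
  ∀ x ∈ J, dx γ x ≠ 0

/-- The curve has constant speed: `|∂ₓ γ| ≡ L[γ]`. -/
def ConstantSpeed {n : ℕ} (γ : ℝ → Space n) : Prop :=
  ∀ x ∈ J, ‖dx γ x‖ = length γ

/-- `γ ∈ W^{2,2}(I; ℝⁿ)`, through the continuous representative: `γ` is `C¹` on `[0, 1]` and `∂ₓ γ`
is the primitive of a square-integrable function `g`, the weak second derivative. -/
def MemW22 {n : ℕ} (γ : ℝ → Space n) : Prop :=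
  ContDiffOn ℝ 1 γ J ∧
    ∃ g : ℝ → Space n, MemLp g 2 (volume.restrict J) ∧
      ∀ x ∈ J, dx γ x = dx γ 0 + ∫ t in (0 : ℝ)..x, g t

/-- `γ + η ε` is a length-preserving variation of `γ`: `η` is smooth in `(ε, x)`, vanishes
at `ε = 0`, has its support in `x` within a fixed compact subset of the open interval `I = (0, 1)`,
and the length of `γ + η ε` is that of `γ` for all small `ε`. -/
structure IsLengthPreservingVariation {n : ℕ} (γ : ℝ → Space n) (η : ℝ → ℝ → Space n) :
    Prop where
  smooth : ContDiff ℝ ∞ (fun p : ℝ × ℝ => η p.1 p.2)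
  initial : ∀ x, η 0 x = 0
  compactSupport : ∃ K : Set ℝ, IsCompact K ∧ K ⊆ Ioo (0 : ℝ) 1 ∧ ∀ ε, ∀ x ∉ K, η ε x = 0
  length_eq : ∀ᶠ ε in 𝓝 (0 : ℝ), length (fun x => γ x + η ε x) = length γ

/-- An elastica: an immersed `W^{2,2}` curve that is a critical point of the bending energy among
curves of fixed length. -/
structure IsElastica {n : ℕ} (γ : ℝ → Space n) : Prop where
  memW22 : MemW22 γ
  immersed : Immersed γ
  critical : ∀ η : ℝ → ℝ → Space n, IsLengthPreservingVariation γ η →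
    HasDerivAt (fun ε : ℝ => bending (fun x => γ x + η ε x)) 0 0

/-- The Euler-Lagrange equation `2 ∇ₛ² κ + |κ|² κ - lam κ = 0` on `[0, 1]`. It is used for curves
that are smooth enough (`C⁴` on `[0, 1]`) for it to have its classical meaning. -/
def SolvesEulerLagrange {n : ℕ} (lam : ℝ) (γ : ℝ → Space n) : Prop :=
  ∀ x ∈ J,
    (2 : ℝ) • normalDeriv γ (normalDeriv γ (curvature γ)) x
      + ‖curvature γ x‖ ^ 2 • curvature γ x - lam • curvature γ x = 0

/-- A `lam`-elastica: an elastica (of class `C⁴` on `[0, 1]`) that solves the Euler-Lagrange equation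
with multiplier `lam` in the classical sense. -/
structure IsLambdaElastica {n : ℕ} (lam : ℝ) (γ : ℝ → Space n) : Prop where
  isElastica : IsElastica γ
  contDiffOn : ContDiffOn ℝ 4 γ J
  eulerLagrange : SolvesEulerLagrange lam γ

/-- The boundedness assumption: `B[γ_j] ≤ C` and `1/C ≤ L[γ_j] ≤ C` for all `j`, for some `C > 0`. -/
def BoundedAssumption {n : ℕ} (γ : ℕ → ℝ → Space n) : Prop :=
  ∃ C : ℝ, 0 < C ∧ ∀ j, bending (γ j) ≤ C ∧ 1 / C ≤ length (γ j) ∧ length (γ j) ≤ C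

/-- Convergence in the space `C^m([0, 1]; ℝⁿ)`: all curves are of class `C^m` on `[0, 1]` and the
derivatives of order at most `m` converge uniformly on `[0, 1]`. -/
structure ConvergesC {n : ℕ} (m : ℕ) (γ : ℕ → ℝ → Space n) (γlim : ℝ → Space n) : Prop where
  contDiffOn_seq : ∀ j, ContDiffOn ℝ m (γ j) J
  contDiffOn_lim : ContDiffOn ℝ m γlim J
  tendsto : ∀ k : ℕ, k ≤ m →
    TendstoUniformlyOn (fun j => iteratedDerivWithin k (γ j) J)
      (iteratedDerivWithin k γlim J) atTop J

end ElasticCurve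

/-! At constant speed `L`, with `a, b, c, d` the first four parameter derivatives, the
Euler-Lagrange equation reads `2L² d + (3|b|² - λL⁴) b + 6⟨b,c⟩ a = 0`. The left side is the
derivative of `2L² c + (3|b|² - λL⁴) a`, which is therefore a constant vector `V`
(`firstIntegral_eq`).

The energy controls `∫|b|² = L³ B`. Testing the first integral against `x - x²` bounds `V`; hence
`|c| ≤ K(1 + |b|²)`, so `c` is bounded in `L¹`, so `b` has bounded oscillation and is bounded, and
then so is `c` (`exists_bound_two_three`). The equation expresses `d` polynomially in `a, b, c`,
which bootstraps to uniform bounds on all derivatives (`uniformlyBoundedDerivs_of_solves`).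
Interpolation then lifts uniform convergence to every order (`exists_tendstoUniformlyOn_deriv`).

The limit has constant speed and solves the equation for any accumulation point of the multipliers.
That it is critical is not a limit of criticality: it follows from the equation by a first variation
computation (`ConstantSpeedJet.critical`), in which the first integral turns the variation of energy
into an exact derivative plus a multiple of the variation of length. -/

namespace ElasticCurve

/-! ### Calculus on the closed interval: interpolation, oscillation, uniform derivative bounds. -/

section Calculus

variable {E : Type*} [NormedAddCommGroup E] [NormedSpace ℝ E]

/-- `f` is differentiable on `[0, 1]` with derivative `g`, one-sided at the endpoints. -/
def HasDerivOnJ (f g : ℝ → E) : Prop :=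
  ∀ x ∈ J, HasDerivWithinAt f (g x) J x

theorem HasDerivOnJ.continuousOn {f g : ℝ → E} (h : HasDerivOnJ f g) : ContinuousOn f J :=
  fun x hx => (h x hx).continuousWithinAt

theorem uniqueDiffOn_J : UniqueDiffOn ℝ J := uniqueDiffOn_Icc_zero_one

theorem HasDerivOnJ.derivWithin {f g : ℝ → E} (h : HasDerivOnJ f g) {x : ℝ} (hx : x ∈ J) :
    derivWithin f J x = g x :=
  (h x hx).derivWithin (uniqueDiffOn_J x hx)

theorem HasDerivOnJ.congr {f g f' g' : ℝ → E} (h : HasDerivOnJ f g) (hf : EqOn f' f J)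
    (hg : EqOn g' g J) : HasDerivOnJ f' g' := by
  intro x hx
  rw [hg hx]
  exact (h x hx).congr hf (hf hx)

/-- Mean value inequality for `t ↦ f t - t • g x`, whose derivative `g t - g x` is at most `M |y -
x|` between `x` and `y`. The sharp factor `1/2` is not needed. -/
theorem norm_taylor_le {f g h : ℝ → E} (hf : HasDerivOnJ f g) (hg : HasDerivOnJ g h) {M : ℝ}
    (hM : ∀ x ∈ J, ‖h x‖ ≤ M) {x y : ℝ} (hx : x ∈ J) (hy : y ∈ J) :
    ‖f y - f x - (y - x) • g x‖ ≤ M * |y - x| ^ 2 := by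
  have hM0 : 0 ≤ M := (norm_nonneg _).trans (hM x hx)
  have hsub : uIcc x y ⊆ J := uIcc_subset_Icc hx hy
  have key := Convex.norm_image_sub_le_of_norm_hasDerivWithin_le
    (f := fun t => f t - t • g x) (f' := fun t => g t - g x) (s := uIcc x y) (x := x) (y := y)
    (C := M * |y - x|) ?_ ?_ (convex_uIcc x y) left_mem_uIcc right_mem_uIcc
  · have : f y - f x - (y - x) • g x = (f y - y • g x) - (f x - x • g x) := by
      rw [sub_smul]; abel
    rw [this]
    calc _ ≤ _ := key
      _ = _ := by rw [Real.norm_eq_abs]; ring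
  · intro t ht
    have h1 := ((hf t (hsub ht)).mono hsub).sub
      ((hasDerivWithinAt_id t (uIcc x y)).smul_const (g x))
    rw [one_smul] at h1
    exact h1
  · intro t ht
    have h1 := Convex.norm_image_sub_le_of_norm_hasDerivWithin_le (f := g) (f' := h) hg hM
      (convex_Icc 0 1) hx (hsub ht)
    refine h1.trans ?_
    rw [Real.norm_eq_abs]
    exact mul_le_mul_of_nonneg_left (abs_sub_left_of_mem_uIcc ht) hM0

/-- Landau-type interpolation: Taylor's estimate at distance `r` from `x`, divided by `r`. Small `ε`
and a well-chosen `r` make the first derivative small. -/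
theorem norm_deriv_le_of_norm_le {f g h : ℝ → E} (hf : HasDerivOnJ f g) (hg : HasDerivOnJ g h)
    {M ε r : ℝ} (hM : ∀ x ∈ J, ‖h x‖ ≤ M) (hε : ∀ x ∈ J, ‖f x‖ ≤ ε) (hr : 0 < r)
    (hr' : r ≤ 1 / 2) {x : ℝ} (hx : x ∈ J) : ‖g x‖ ≤ 2 * ε / r + M * r := by
  -- On one side of `x` the interval has room at least `1/2`, hence the restriction on `r`.
  obtain ⟨y, hy, hxy⟩ : ∃ y ∈ J, |y - x| = r := by
    rcases le_total x (1 / 2) with h1 | h1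
    · exact ⟨x + r, ⟨by linarith [hx.1], by linarith⟩, by simp [abs_of_pos hr]⟩
    · exact ⟨x - r, ⟨by linarith, by linarith [hx.2]⟩, by simp [abs_of_pos hr]⟩
  have h1 := norm_taylor_le hf hg hM hx hy
  have h2 : r * ‖g x‖ ≤ M * r ^ 2 + 2 * ε := by
    calc r * ‖g x‖ = ‖(y - x) • g x‖ := by rw [norm_smul, Real.norm_eq_abs, hxy]
      _ = ‖(f y - f x) - (f y - f x - (y - x) • g x)‖ := by congr 1; abel
      _ ≤ ‖f y - f x‖ + ‖f y - f x - (y - x) • g x‖ := norm_sub_le _ _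
      _ ≤ (‖f y‖ + ‖f x‖) + M * r ^ 2 := by
        rw [hxy] at h1
        exact add_le_add (norm_sub_le _ _) h1
      _ ≤ _ := by linarith [hε x hx, hε y hy]
  rw [div_add' _ _ _ hr.ne', le_div_iff₀ hr]
  linarith

/-- Uniform convergence together with a uniform bound on second derivatives gives uniform
convergence of the first derivatives. -/
theorem exists_tendstoUniformlyOn_deriv [CompleteSpace E] {u v w : ℕ → ℝ → E} {U : ℝ → E} {M : ℝ}
    (huv : ∀ j, HasDerivOnJ (u j) (v j)) (hvw : ∀ j, HasDerivOnJ (v j) (w j))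
    (hM : ∀ j, ∀ x ∈ J, ‖w j x‖ ≤ M) (hu : TendstoUniformlyOn u U atTop J) :
    ∃ V : ℝ → E, TendstoUniformlyOn v V atTop J ∧ HasDerivOnJ U V := by
  have hM0 : 0 ≤ M := (norm_nonneg _).trans (hM 0 0 ⟨le_rfl, zero_le_one⟩)
  have hsubd : ∀ {f g f' g' : ℝ → E}, HasDerivOnJ f g → HasDerivOnJ f' g' →
      HasDerivOnJ (fun x => f x - f' x) (fun x => g x - g' x) :=
    fun h1 h2 x hx => (h1 x hx).sub (h2 x hx)
  have hcauchy : UniformCauchySeqOn v atTop J := by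
    rw [Metric.uniformCauchySeqOn_iff]
    intro δ hδ
    -- Differences of the `w j` are bounded by `2 * M`. Each of the two interpolation terms is made
    -- at most `δ / 4`; `M + 1` guards against `M = 0`.
    obtain ⟨r, hr, hr', hr2⟩ : ∃ r : ℝ, 0 < r ∧ r ≤ 1 / 2 ∧ (2 * M) * r ≤ δ / 4 := by
      refine ⟨min (1 / 2) (δ / (8 * (M + 1))), by positivity, min_le_left _ _, ?_⟩
      calc (2 * M) * min (1 / 2) (δ / (8 * (M + 1)))
          ≤ (2 * (M + 1)) * (δ / (8 * (M + 1))) :=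
            mul_le_mul (by linarith) (min_le_right _ _) (by positivity) (by positivity)
        _ = δ / 4 := by field_simp; norm_num
    obtain ⟨N, hN⟩ := Metric.uniformCauchySeqOn_iff.1 hu.uniformCauchySeqOn (δ * r / 8)
      (by positivity)
    refine ⟨N, fun m hm k hk x hx => ?_⟩
    have h1 := norm_deriv_le_of_norm_le (hsubd (huv m) (huv k)) (hsubd (hvw m) (hvw k))
      (M := 2 * M) (ε := δ * r / 8) (r := r)
      (fun x hx => (norm_sub_le _ _).trans (by linarith [hM m x hx, hM k x hx]))
      (fun x hx => by
        have := hN m hm k hk x hx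
        rw [dist_eq_norm] at this
        exact this.le) hr hr' hx
    rw [dist_eq_norm]
    refine h1.trans_lt ?_
    have h3 : 2 * (δ * r / 8) / r = δ / 4 := by field_simp; norm_num
    rw [h3]
    linarith
  have hex : ∀ x, ∃ V, x ∈ J → Tendsto (fun j => v j x) atTop (𝓝 V) := by
    intro x
    by_cases hx : x ∈ J
    · obtain ⟨V, hV⟩ := cauchySeq_tendsto_of_complete (hcauchy.cauchySeq hx)
      exact ⟨V, fun _ => hV⟩
    · exact ⟨0, fun h => absurd h hx⟩
  choose V hV using hex
  refine ⟨V, hcauchy.tendstoUniformlyOn_of_tendsto hV, fun x hx => ?_⟩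
  -- Taylor's estimate is uniform in `j`, so it survives the pointwise limit and identifies `V` as
  -- the derivative of `U`.
  have htaylor : ∀ y ∈ J, ‖U y - U x - (y - x) • V x‖ ≤ M * |y - x| ^ 2 := by
    intro y hy
    have h1 : Tendsto (fun j => ‖u j y - u j x - (y - x) • v j x‖) atTop
        (𝓝 ‖U y - U x - (y - x) • V x‖) :=
      (((hu.tendsto_at hy).sub (hu.tendsto_at hx)).sub ((hV x hx).const_smul _)).norm
    exact le_of_tendsto' h1 fun j => norm_taylor_le (huv j) (hvw j) (hM j) hx hy
  rw [hasDerivWithinAt_iff_isLittleO]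
  have hO : (fun y => U y - U x - (y - x) • V x) =O[𝓝[J] x] fun y => (y - x) ^ 2 := by
    refine Asymptotics.IsBigO.of_bound M ?_
    filter_upwards [self_mem_nhdsWithin] with y hy
    simpa using htaylor y hy
  refine hO.trans_isLittleO ?_
  have h2 : (fun y : ℝ => (y - x) ^ 2) =o[𝓝 x] fun y => y - x := by
    exact
      (Asymptotics.isLittleO_pow_id (𝕜 := ℝ) one_lt_two).comp_tendsto
        (show Tendsto (fun y : ℝ => y - x) (𝓝 x) (𝓝 0) by
          exact Continuous.tendsto' (by fun_prop) x 0 (by simp))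
  exact h2.mono nhdsWithin_le_nhds

theorem HasDerivOnJ.integral_eq_sub [CompleteSpace E] {f g : ℝ → E} (h : HasDerivOnJ f g)
    (hg : ContinuousOn g J) {x y : ℝ} (hx : 0 ≤ x) (hxy : x ≤ y) (hy : y ≤ 1) :
    ∫ t in x..y, g t = f y - f x := by
  have hsub : Icc x y ⊆ J := Icc_subset_Icc hx hy
  refine intervalIntegral.integral_eq_sub_of_hasDerivAt_of_le hxy (h.continuousOn.mono hsub)
    (fun t ht => (h t (hsub (Ioo_subset_Icc_self ht))).hasDerivAt
      (Icc_mem_nhds (by linarith [ht.1]) (by linarith [ht.2]))) ?_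
  exact (hg.mono hsub).intervalIntegrable_of_Icc hxy

/-- An `L¹` bound on the derivative suffices to control oscillation. This matters because at first
only integrals of `|b|²` are under control. -/
theorem norm_sub_le_of_norm_deriv_le_integral [CompleteSpace E] {f g : ℝ → E} {h : ℝ → ℝ} {K : ℝ}
    (hf : HasDerivOnJ f g) (hg : ContinuousOn g J) (hh : ContinuousOn h J)
    (hgh : ∀ x ∈ J, ‖g x‖ ≤ h x) (hK : ∫ x in (0 : ℝ)..1, h x ≤ K) {x y : ℝ}
    (hx : x ∈ J) (hy : y ∈ J) : ‖f y - f x‖ ≤ K := by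
  wlog hxy : x ≤ y generalizing x y
  · rw [norm_sub_rev]
    exact this hy hx (le_of_not_ge hxy)
  have hsub : Icc x y ⊆ J := Icc_subset_Icc hx.1 hy.2
  rw [← hf.integral_eq_sub hg hx.1 hxy hy.2]
  calc ‖∫ t in x..y, g t‖ ≤ ∫ t in x..y, h t :=
        intervalIntegral.norm_integral_le_of_norm_le hxy
          (Eventually.of_forall fun t ht => hgh t (hsub (Ioc_subset_Icc_self ht)))
          ((hh.mono hsub).intervalIntegrable_of_Icc hxy)
    _ ≤ ∫ t in (0 : ℝ)..1, h t := by
        refine intervalIntegral.integral_mono_interval hx.1 hxy hy.2 ?_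
          (hh.intervalIntegrable_of_Icc zero_le_one)
        filter_upwards [ae_restrict_mem measurableSet_Ioc] with t ht
        exact (norm_nonneg _).trans (hgh t (Ioc_subset_Icc_self ht))
    _ ≤ K := hK

/-- A family of functions which is uniformly bounded on `[0, 1]` together with its derivatives of
order at most `m`. -/
def UniformlyBoundedDerivs : ℕ → (ℕ → ℝ → E) → Prop
  | 0, u => (∀ j, ContinuousOn (u j) J) ∧ ∃ M, ∀ j, ∀ x ∈ J, ‖u j x‖ ≤ M
  | m + 1, u => (∃ M, ∀ j, ∀ x ∈ J, ‖u j x‖ ≤ M) ∧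
      ∃ v : ℕ → ℝ → E, (∀ j, HasDerivOnJ (u j) (v j)) ∧ UniformlyBoundedDerivs m v

namespace UniformlyBoundedDerivs

theorem bounded {m : ℕ} {u : ℕ → ℝ → E} (h : UniformlyBoundedDerivs m u) :
    ∃ M, ∀ j, ∀ x ∈ J, ‖u j x‖ ≤ M := by
  cases m with
  | zero => exact h.2
  | succ m => exact h.1

theorem of_succ {m : ℕ} {u : ℕ → ℝ → E} (h : UniformlyBoundedDerivs (m + 1) u) :
    UniformlyBoundedDerivs m u := by
  induction m generalizing u with
  | zero =>
    obtain ⟨hM, v, hv, -⟩ := h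
    exact ⟨fun j => (hv j).continuousOn, hM⟩
  | succ m ih =>
    obtain ⟨hM, v, hv, hb⟩ := h
    exact ⟨hM, v, hv, ih hb⟩

theorem congr {m : ℕ} {u u' : ℕ → ℝ → E} (h : UniformlyBoundedDerivs m u)
    (hu : ∀ j, EqOn (u' j) (u j) J) : UniformlyBoundedDerivs m u' := by
  have hb : ∃ M, ∀ j, ∀ x ∈ J, ‖u' j x‖ ≤ M := by
    obtain ⟨M, hM⟩ := h.bounded
    exact ⟨M, fun j x hx => by rw [hu j hx]; exact hM j x hx⟩
  cases m with
  | zero => exact ⟨fun j => (h.1 j).congr (hu j), hb⟩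
  | succ m =>
    obtain ⟨-, v, hv, hvb⟩ := h
    exact ⟨hb, v, fun j => (hv j).congr (hu j) fun _ _ => rfl, hvb⟩

theorem add {m : ℕ} {u u' : ℕ → ℝ → E} (h : UniformlyBoundedDerivs m u)
    (h' : UniformlyBoundedDerivs m u') :
    UniformlyBoundedDerivs m (fun j x => u j x + u' j x) := by
  have hb : ∃ M, ∀ j, ∀ x ∈ J, ‖u j x + u' j x‖ ≤ M := by
    obtain ⟨M, hM⟩ := h.bounded
    obtain ⟨M', hM'⟩ := h'.bounded
    exact ⟨M + M', fun j x hx => (norm_add_le _ _).trans (add_le_add (hM j x hx) (hM' j x hx))⟩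
  induction m generalizing u u' with
  | zero => exact ⟨fun j => (h.1 j).add (h'.1 j), hb⟩
  | succ m ih =>
    obtain ⟨-, v, hv, hvb⟩ := h
    obtain ⟨-, v', hv', hvb'⟩ := h'
    refine ⟨hb, _, fun j x hx => (hv j x hx).add (hv' j x hx), ih hvb hvb' ?_⟩
    obtain ⟨M, hM⟩ := hvb.bounded
    obtain ⟨M', hM'⟩ := hvb'.bounded
    exact ⟨M + M', fun j x hx => (norm_add_le _ _).trans (add_le_add (hM j x hx) (hM' j x hx))⟩

/-- The Leibniz rule, stated once for all the products in the Euler-Lagrange equation: inner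
products, products of reals, and scalar multiples. -/
theorem bilinear {F G : Type*} [NormedAddCommGroup F] [NormedSpace ℝ F] [NormedAddCommGroup G]
    [NormedSpace ℝ G] (B : E →L[ℝ] F →L[ℝ] G) {m : ℕ} {u : ℕ → ℝ → E} {w : ℕ → ℝ → F}
    (h : UniformlyBoundedDerivs m u) (h' : UniformlyBoundedDerivs m w) :
    UniformlyBoundedDerivs m (fun j x => B (u j x) (w j x)) := by
  have hb : ∀ {m : ℕ} {u : ℕ → ℝ → E} {w : ℕ → ℝ → F}, UniformlyBoundedDerivs m u →
      UniformlyBoundedDerivs m w → ∃ M, ∀ j, ∀ x ∈ J, ‖B (u j x) (w j x)‖ ≤ M := by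
    intro m u w h h'
    obtain ⟨M, hM⟩ := h.bounded
    obtain ⟨M', hM'⟩ := h'.bounded
    have hM0 : 0 ≤ M := (norm_nonneg _).trans (hM 0 0 ⟨le_rfl, zero_le_one⟩)
    refine ⟨‖B‖ * M * M', fun j x hx => (B.le_opNorm₂ _ _).trans ?_⟩
    gcongr
    · exact hM j x hx
    · exact hM' j x hx
  induction m generalizing u w with
  | zero =>
    exact ⟨fun j => (B.continuous.comp_continuousOn (h.1 j)).clm_apply (h'.1 j), hb h h'⟩
  | succ m ih =>
    obtain ⟨-, v, hv, hvb⟩ := id h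
    obtain ⟨-, v', hv', hvb'⟩ := id h'
    refine ⟨hb h h', _, fun j x hx => ?_, (ih h.of_succ hvb').add (ih hvb h'.of_succ)⟩
    exact B.hasDerivWithinAt_of_bilinear (hv j x hx) (hv' j x hx)

theorem const {c : ℕ → E} {M : ℝ} (hc : ∀ j, ‖c j‖ ≤ M) (m : ℕ) :
    UniformlyBoundedDerivs m (fun j _ => c j) := by
  have hzero : ∀ m, UniformlyBoundedDerivs m (fun (_ : ℕ) (_ : ℝ) => (0 : E)) := by
    intro m
    induction m with
    | zero => exact ⟨fun _ => continuousOn_const, 0, fun _ _ _ => by simp⟩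
    | succ m ih =>
      exact ⟨⟨0, fun _ _ _ => by simp⟩, _, fun _ _ _ => hasDerivWithinAt_const _ _ _, ih⟩
  cases m with
  | zero => exact ⟨fun _ => continuousOn_const, M, fun j _ _ => hc j⟩
  | succ m => exact ⟨⟨M, fun j _ _ => hc j⟩, _, fun _ _ _ => hasDerivWithinAt_const _ _ _, hzero m⟩

theorem iteratedDerivWithin {m : ℕ} {u : ℕ → ℝ → E} (h : UniformlyBoundedDerivs m u) :
    ∃ M, ∀ j, ∀ x ∈ J, ‖iteratedDerivWithin m (u j) J x‖ ≤ M := by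
  induction m generalizing u with
  | zero => simpa using h.bounded
  | succ m ih =>
    obtain ⟨-, v, hv, hvb⟩ := h
    obtain ⟨M, hM⟩ := ih hvb
    refine ⟨M, fun j x hx => ?_⟩
    have h1 : EqOn (derivWithin (u j) J) (v j) J := fun y hy => (hv j).derivWithin hy
    rw [iteratedDerivWithin_succ', iteratedDerivWithin_congr h1 hx]
    exact hM j x hx

end UniformlyBoundedDerivs

end Calculus

/-! ### The Euler-Lagrange equation at constant speed and its first integral. -/

section EulerLagrange

variable {n : ℕ}

theorem HasDerivOnJ.eq_zero_of_const {E : Type*} [NormedAddCommGroup E] [NormedSpace ℝ E]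
    {f g : ℝ → E} (h : HasDerivOnJ f g) {k : E} (hk : ∀ x ∈ J, f x = k) :
    ∀ x ∈ J, g x = 0 := by
  intro x hx
  have h1 : HasDerivOnJ f fun _ => (0 : E) := fun y hy =>
    (hasDerivWithinAt_const y J k).congr hk (hk y hy)
  rw [← h.derivWithin hx, h1.derivWithin hx]

theorem HasDerivOnJ.eq_of_zero {E : Type*} [NormedAddCommGroup E] [NormedSpace ℝ E]
    {f g : ℝ → E} (h : HasDerivOnJ f g) (hg : ∀ x ∈ J, g x = 0) :
    ∀ x ∈ J, f x = f 0 := by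
  refine constant_of_derivWithin_zero (fun x hx => (h x hx).differentiableWithinAt) fun x hx => ?_
  have hx' := Ico_subset_Icc_self hx
  rw [h.derivWithin hx', hg x hx']

theorem HasDerivOnJ.inner {f g f' g' : ℝ → Space n} (hf : HasDerivOnJ f f')
    (hg : HasDerivOnJ g g') :
    HasDerivOnJ (fun x => inner ℝ (f x) (g x))
      (fun x => inner ℝ (f x) (g' x) + inner ℝ (f' x) (g x)) :=
  fun x hx => (hf x hx).inner ℝ (hg x hx)

/-- A curve of constant speed `L > 0`, together with its first four derivatives. -/
structure ConstantSpeedJet (L : ℝ) (γ a b c d : ℝ → Space n) : Prop where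
  pos : 0 < L
  deriv₁ : HasDerivOnJ γ a
  deriv₂ : HasDerivOnJ a b
  deriv₃ : HasDerivOnJ b c
  deriv₄ : HasDerivOnJ c d
  speed : ∀ x ∈ J, ‖a x‖ = L

namespace ConstantSpeedJet

variable {L : ℝ} {γ a b c d : ℝ → Space n}

theorem inner_one_one (h : ConstantSpeedJet L γ a b c d) :
    ∀ x ∈ J, inner ℝ (a x) (a x) = L ^ 2 := by
  intro x hx
  rw [real_inner_self_eq_norm_sq, h.speed x hx]

/-- Successive differentiation of `|a|² = L²` yields this relation and those for `c` and `d`; they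
evaluate every tangential projection in `normalDeriv`. -/
theorem inner_one_two (h : ConstantSpeedJet L γ a b c d) :
    ∀ x ∈ J, inner ℝ (a x) (b x) = 0 := by
  intro x hx
  have := (h.deriv₂.inner h.deriv₂).eq_zero_of_const h.inner_one_one x hx
  simp only [real_inner_comm (a x) (b x)] at this
  linarith

theorem inner_one_three (h : ConstantSpeedJet L γ a b c d) :
    ∀ x ∈ J, inner ℝ (a x) (c x) = -‖b x‖ ^ 2 := by
  intro x hx
  have := (h.deriv₂.inner h.deriv₃).eq_zero_of_const h.inner_one_two x hx
  simp only [real_inner_self_eq_norm_sq] at this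
  linarith

theorem norm_sq_two (h : ConstantSpeedJet L γ a b c d) :
    HasDerivOnJ (fun x => ‖b x‖ ^ 2) (fun x => 2 * inner ℝ (b x) (c x)) :=
  fun x hx => (h.deriv₃ x hx).norm_sq

theorem inner_one_four (h : ConstantSpeedJet L γ a b c d) :
    ∀ x ∈ J, inner ℝ (a x) (d x) = -(3 * inner ℝ (b x) (c x)) := by
  intro x hx
  have h1 : HasDerivOnJ (fun x => inner ℝ (a x) (c x) + ‖b x‖ ^ 2) _ := fun x hx =>
    (h.deriv₂.inner h.deriv₄ x hx).add (h.norm_sq_two x hx)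
  have := h1.eq_zero_of_const (k := 0) (fun x hx => by rw [h.inner_one_three x hx]; ring) x hx
  linarith

theorem ds_eq (h : ConstantSpeedJet L γ a b c d) {X Y : ℝ → Space n} (hX : HasDerivOnJ X Y) :
    EqOn (ds γ X) (fun x => L⁻¹ • Y x) J := by
  intro x hx
  simp only [ds, dx]
  rw [h.deriv₁.derivWithin hx, h.speed x hx, hX.derivWithin hx]

theorem tangent_eq (h : ConstantSpeedJet L γ a b c d) :
    EqOn (tangent γ) (fun x => L⁻¹ • a x) J :=
  h.ds_eq h.deriv₁

theorem curvature_eq (h : ConstantSpeedJet L γ a b c d) :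
    EqOn (curvature γ) (fun x => (L⁻¹) ^ 2 • b x) J := by
  have h1 : HasDerivOnJ (ds γ γ) (fun x => L⁻¹ • b x) := HasDerivOnJ.congr
    (fun x hx => (h.deriv₂ x hx).const_smul L⁻¹) h.tangent_eq fun _ _ => rfl
  intro x hx
  rw [curvature, h.ds_eq h1 hx]
  simp only [smul_smul, sq]

theorem normalDeriv_curvature_eq (h : ConstantSpeedJet L γ a b c d) :
    EqOn (normalDeriv γ (curvature γ))
      (fun x => (L⁻¹) ^ 3 • c x + ((L⁻¹) ^ 5 * ‖b x‖ ^ 2) • a x) J := by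
  have h1 : HasDerivOnJ (curvature γ) (fun x => (L⁻¹) ^ 2 • c x) := HasDerivOnJ.congr
    (fun x hx => (h.deriv₃ x hx).const_smul _) h.curvature_eq fun _ _ => rfl
  intro x hx
  simp only [normalDeriv, h.ds_eq h1 hx, h.tangent_eq hx, inner_smul_left, inner_smul_right,
    real_inner_comm (a x) (c x), h.inner_one_three x hx, conj_trivial]
  module

/-- Differentiating the formula for `∇ₛ κ` gives `2⟨b,c⟩` in the coefficient of `a`. Since `⟨a,d⟩ =
-3⟨b,c⟩`, subtracting the tangential part adds one more `⟨b,c⟩`, whence the factor 3. -/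
theorem normalDeriv_normalDeriv_curvature_eq (h : ConstantSpeedJet L γ a b c d) :
    EqOn (normalDeriv γ (normalDeriv γ (curvature γ)))
      (fun x => (L⁻¹) ^ 4 • d x + (3 * (L⁻¹) ^ 6 * inner ℝ (b x) (c x)) • a x
        + ((L⁻¹) ^ 6 * ‖b x‖ ^ 2) • b x) J := by
  have h1 : HasDerivOnJ (normalDeriv γ (curvature γ)) (fun x => (L⁻¹) ^ 3 • d x +
      (((L⁻¹) ^ 5 * ‖b x‖ ^ 2) • b x + ((L⁻¹) ^ 5 * (2 * inner ℝ (b x) (c x))) • a x)) :=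
    HasDerivOnJ.congr (fun x hx => ((h.deriv₄ x hx).const_smul ((L⁻¹) ^ 3)).add
      (((h.norm_sq_two x hx).const_mul ((L⁻¹) ^ 5)).smul (h.deriv₂ x hx)))
      h.normalDeriv_curvature_eq fun _ _ => rfl
  intro x hx
  have hL := h.pos.ne'
  simp only [normalDeriv, h.ds_eq h1 hx, h.tangent_eq hx, inner_smul_left, inner_smul_right,
    inner_add_left, real_inner_comm (a x) (d x), h.inner_one_four x hx,
    real_inner_comm (a x) (b x), h.inner_one_two x hx, h.inner_one_one x hx, conj_trivial]
  match_scalars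
  · field_simp
  · field_simp
  · field_simp
    ring

/-- The derivative of the first integral of the Euler-Lagrange equation. -/
theorem hasDerivOnJ_firstIntegral (h : ConstantSpeedJet L γ a b c d) (lam : ℝ) :
    HasDerivOnJ (fun x => (2 * L ^ 2) • c x + (3 * ‖b x‖ ^ 2 - lam * L ^ 4) • a x)
      (fun x => (2 * L ^ 2) • d x + ((3 * ‖b x‖ ^ 2 - lam * L ^ 4) • b x
        + (6 * inner ℝ (b x) (c x)) • a x)) := by
  intro x hx
  have h1 := (((h.norm_sq_two x hx).const_mul 3).sub_const (lam * L ^ 4)).smul (h.deriv₂ x hx)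
  refine (((h.deriv₄ x hx).const_smul (2 * L ^ 2)).add h1).congr_deriv ?_
  module

/-- The equation multiplied by `L⁶`. The coefficient 3 is 2 from `2∇ₛ²κ` plus 1 from `|κ|²κ`; the
result is exactly the derivative in `hasDerivOnJ_firstIntegral`. -/
theorem solvesEulerLagrange_iff (h : ConstantSpeedJet L γ a b c d) (lam : ℝ) :
    SolvesEulerLagrange lam γ ↔ ∀ x ∈ J, (2 * L ^ 2) • d x +
      ((3 * ‖b x‖ ^ 2 - lam * L ^ 4) • b x + (6 * inner ℝ (b x) (c x)) • a x) = 0 := by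
  have hL := h.pos.ne'
  have key : ∀ x ∈ J, (2 : ℝ) • normalDeriv γ (normalDeriv γ (curvature γ)) x
      + ‖curvature γ x‖ ^ 2 • curvature γ x - lam • curvature γ x = (L⁻¹) ^ 6 •
      ((2 * L ^ 2) • d x + ((3 * ‖b x‖ ^ 2 - lam * L ^ 4) • b x
        + (6 * inner ℝ (b x) (c x)) • a x)) := by
    intro x hx
    rw [h.normalDeriv_normalDeriv_curvature_eq hx, h.curvature_eq hx]
    simp only [norm_smul, norm_pow, norm_inv, Real.norm_of_nonneg h.pos.le]
    have h4 : (L⁻¹) ^ 4 = (L⁻¹) ^ 6 * L ^ 2 := by field_simp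
    have h2 : (L⁻¹) ^ 2 = (L⁻¹) ^ 6 * L ^ 4 := by field_simp
    match_scalars
    · field_simp
    · field_simp
      try ring
    · field_simp
      try ring
  refine forall₂_congr fun x hx => ?_
  rw [key x hx, smul_eq_zero_iff_right (by positivity)]

theorem firstIntegral_eq (h : ConstantSpeedJet L γ a b c d) {lam : ℝ}
    (hEL : SolvesEulerLagrange lam γ) :
    ∃ V : Space n, ∀ x ∈ J,
      (2 * L ^ 2) • c x + (3 * ‖b x‖ ^ 2 - lam * L ^ 4) • a x = V :=
  ⟨_, (h.hasDerivOnJ_firstIntegral lam).eq_of_zero ((h.solvesEulerLagrange_iff lam).1 hEL)⟩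

theorem length_eq (h : ConstantSpeedJet L γ a b c d) : length γ = L := by
  have h1 : EqOn (fun x => ‖dx γ x‖) (fun _ => L) (uIcc 0 1) := by
    intro x hx
    rw [uIcc_of_le zero_le_one] at hx
    simp only [dx]
    rw [h.deriv₁.derivWithin hx, h.speed x hx]
  rw [length, intervalIntegral.integral_congr h1]
  simp

theorem bending_eq (h : ConstantSpeedJet L γ a b c d) :
    bending γ = (L⁻¹) ^ 3 * ∫ x in (0 : ℝ)..1, ‖b x‖ ^ 2 := by
  rw [bending, ← intervalIntegral.integral_const_mul]
  refine intervalIntegral.integral_congr fun x hx => ?_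
  rw [uIcc_of_le zero_le_one] at hx
  have hL := h.pos.ne'
  simp only [dx]
  rw [h.deriv₁.derivWithin hx, h.speed x hx, h.curvature_eq hx]
  simp only [norm_smul, norm_pow, norm_inv, Real.norm_of_nonneg h.pos.le]
  field_simp

end ConstantSpeedJet

end EulerLagrange

/-! ### A priori bounds and bootstrapping. -/

section Bounds

variable {n : ℕ}

namespace ConstantSpeedJet

variable {L : ℝ} {γ a b c d : ℝ → Space n}

theorem integral_norm_sq_two_le (h : ConstantSpeedJet L γ a b c d) {C : ℝ} (hC : 0 < C)
    (hLC : L ≤ C) (hB : bending γ ≤ C) : ∫ x in (0 : ℝ)..1, ‖b x‖ ^ 2 ≤ C ^ 4 := by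
  have hL := h.pos
  have h1 : ∫ x in (0 : ℝ)..1, ‖b x‖ ^ 2 = L ^ 3 * bending γ := by
    rw [h.bending_eq]
    field_simp
  rw [h1]
  calc L ^ 3 * bending γ ≤ L ^ 3 * C := by gcongr
    _ ≤ C ^ 3 * C := by gcongr
    _ = C ^ 4 := by ring

theorem norm_coeff_smul_le (h : ConstantSpeedJet L γ a b c d) {C Λ lam : ℝ} (hC : 0 < C)
    (hLC : L ≤ C) (hlam : |lam| ≤ Λ) {x : ℝ} (hx : x ∈ J) :
    ‖(3 * ‖b x‖ ^ 2 - lam * L ^ 4) • a x‖ ≤ (3 * C + Λ * C ^ 5) * (1 + ‖b x‖ ^ 2) := by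
  have hL := h.pos
  have hΛ : 0 ≤ Λ := (abs_nonneg _).trans hlam
  have h1 : ‖3 * ‖b x‖ ^ 2 - lam * L ^ 4‖ ≤ 3 * ‖b x‖ ^ 2 + Λ * C ^ 4 := by
    refine (norm_sub_le _ _).trans (add_le_add ?_ ?_)
    · rw [Real.norm_of_nonneg (by positivity)]
    · rw [Real.norm_eq_abs, abs_mul, abs_of_pos (pow_pos hL 4)]
      gcongr
  rw [norm_smul, h.speed x hx]
  calc _ ≤ (3 * ‖b x‖ ^ 2 + Λ * C ^ 4) * C := by gcongr
    -- The missing cross terms are added so that the bound factors as a constant times `1 + |b|²`.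
    _ ≤ (3 * ‖b x‖ ^ 2 + Λ * C ^ 4) * C + (3 * C + Λ * C ^ 5 * ‖b x‖ ^ 2) :=
      le_add_of_nonneg_right (by positivity)
    _ = _ := by ring

theorem continuousOn_one_add_norm_sq (h : ConstantSpeedJet L γ a b c d) (K : ℝ) :
    ContinuousOn (fun x => K * (1 + ‖b x‖ ^ 2)) J :=
  continuousOn_const.mul (continuousOn_const.add (h.deriv₃.continuousOn.norm.pow 2))

theorem integral_one_add_norm_sq_le (h : ConstantSpeedJet L γ a b c d) {A K : ℝ} (hK : 0 ≤ K)
    (hA : ∫ x in (0 : ℝ)..1, ‖b x‖ ^ 2 ≤ A) :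
    ∫ x in (0 : ℝ)..1, K * (1 + ‖b x‖ ^ 2) ≤ K * (1 + A) := by
  have hint : IntervalIntegrable (fun x => ‖b x‖ ^ 2) volume 0 1 :=
    (h.deriv₃.continuousOn.norm.pow 2).intervalIntegrable_of_Icc zero_le_one
  rw [intervalIntegral.integral_const_mul,
    intervalIntegral.integral_add intervalIntegrable_const hint]
  simp only [intervalIntegral.integral_const, sub_zero, smul_eq_mul, mul_one]
  gcongr

/-- The first integral is bounded in terms of length, multiplier and bending energy, as one sees by
testing it against `x - x ^ 2`. -/
theorem norm_firstIntegral_le (h : ConstantSpeedJet L γ a b c d) {C Λ lam A : ℝ} (hC : 0 < C)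
    (hLC : L ≤ C) (hlam : |lam| ≤ Λ) (hA : ∫ x in (0 : ℝ)..1, ‖b x‖ ^ 2 ≤ A) {V : Space n}
    (hV : ∀ x ∈ J, (2 * L ^ 2) • c x + (3 * ‖b x‖ ^ 2 - lam * L ^ 4) • a x = V) :
    ‖V‖ ≤ 6 * ((2 * C ^ 2 + (3 * C + Λ * C ^ 5)) * (1 + A)) := by
  have hL := h.pos
  have hΛ : 0 ≤ Λ := (abs_nonneg _).trans hlam
  -- The weight `x - x²` vanishes at both ends, so the still uncontrolled endpoint values of `b`
  -- drop out. Its primitive `x²/2 - x³/3` runs from 0 to `1/6`, so the increment of this function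
  -- over `[0, 1]` is `-V/6`; the derivative contains no `c`.
  have hH : HasDerivOnJ
      (fun x => (2 * L ^ 2 * (x - x ^ 2)) • b x - (x ^ 2 / 2 - x ^ 3 / 3) • V)
      (fun x => (2 * L ^ 2 * (1 - 2 * x)) • b x -
        (x - x ^ 2) • ((3 * ‖b x‖ ^ 2 - lam * L ^ 4) • a x)) := by
    intro x hx
    have e1 : HasDerivWithinAt (fun x : ℝ => 2 * L ^ 2 * (x - x ^ 2)) (2 * L ^ 2 * (1 - 2 * x))
        J x := by
      have := ((hasDerivAt_id x).sub (hasDerivAt_pow 2 x)).const_mul (2 * L ^ 2)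
      simpa using this.hasDerivWithinAt
    have e2 : HasDerivWithinAt (fun x : ℝ => x ^ 2 / 2 - x ^ 3 / 3) (x - x ^ 2) J x := by
      have := ((hasDerivAt_pow 2 x).div_const 2).sub ((hasDerivAt_pow 3 x).div_const 3)
      refine (this.congr_deriv ?_).hasDerivWithinAt
      norm_num
    refine ((e1.smul (h.deriv₃ x hx)).sub (e2.smul_const V)).congr_deriv ?_
    rw [← hV x hx]
    module
  have hHc : ContinuousOn (fun x => (2 * L ^ 2 * (1 - 2 * x)) • b x -
        (x - x ^ 2) • ((3 * ‖b x‖ ^ 2 - lam * L ^ 4) • a x)) J := by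
    have := h.deriv₂.continuousOn
    have := h.deriv₃.continuousOn
    fun_prop
  have hK : 0 ≤ 2 * C ^ 2 + (3 * C + Λ * C ^ 5) := by positivity
  have key := norm_sub_le_of_norm_deriv_le_integral hH hHc
    (h.continuousOn_one_add_norm_sq (2 * C ^ 2 + (3 * C + Λ * C ^ 5))) (fun x hx => ?_)
    (h.integral_one_add_norm_sq_le hK hA)
    (x := 0) (y := 1) ⟨le_rfl, zero_le_one⟩ ⟨zero_le_one, le_rfl⟩
  · norm_num at key
    rw [norm_smul] at key
    norm_num at key
    linarith
  · have hb : ‖b x‖ ≤ 1 + ‖b x‖ ^ 2 := by nlinarith [sq_nonneg (‖b x‖ - 1)]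
    have t1 : ‖(2 * L ^ 2 * (1 - 2 * x)) • b x‖ ≤ 2 * C ^ 2 * (1 + ‖b x‖ ^ 2) := by
      have : |1 - 2 * x| ≤ 1 := abs_le.2 ⟨by linarith [hx.2], by linarith [hx.1]⟩
      rw [norm_smul, norm_mul, Real.norm_of_nonneg (by positivity : 0 ≤ 2 * L ^ 2),
        Real.norm_eq_abs]
      calc 2 * L ^ 2 * |1 - 2 * x| * ‖b x‖ ≤ 2 * C ^ 2 * 1 * (1 + ‖b x‖ ^ 2) := by gcongr
        _ = _ := by ring
    have t2 : ‖(x - x ^ 2) • ((3 * ‖b x‖ ^ 2 - lam * L ^ 4) • a x)‖ ≤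
        (3 * C + Λ * C ^ 5) * (1 + ‖b x‖ ^ 2) := by
      have : |x - x ^ 2| ≤ 1 :=
        abs_le.2 ⟨by nlinarith [hx.1, hx.2], by nlinarith [hx.1, hx.2]⟩
      rw [norm_smul, Real.norm_eq_abs]
      exact (mul_le_of_le_one_left (norm_nonneg _) this).trans (h.norm_coeff_smul_le hC hLC hlam hx)
    refine (norm_sub_le _ _).trans ((add_le_add t1 t2).trans_eq ?_)
    ring

end ConstantSpeedJet

/-- Bounds on the second and third derivatives of an elastica of constant speed in terms of its
length, its multiplier and its bending energy. -/
theorem exists_bound_two_three {C : ℝ} (hC : 0 < C) (Λ : ℝ) :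
    ∃ M, ∀ {L lam : ℝ} {γ a b c d : ℝ → Space n}, ConstantSpeedJet L γ a b c d →
      SolvesEulerLagrange lam γ → L ≤ C → 1 / C ≤ L → |lam| ≤ Λ → bending γ ≤ C →
      ∀ x ∈ J, ‖b x‖ ≤ M ∧ ‖c x‖ ≤ M := by
  -- Roles: `A` bounds `∫|b|²`, `K₁` bounds the first integral, `K₂` bounds `|c| / (1 + |b|²)`, and
  -- `M` bounds `|b|`.
  set A : ℝ := C ^ 4 with hAdef
  set K : ℝ := 3 * C + Λ * C ^ 5
  set K₁ : ℝ := 6 * ((2 * C ^ 2 + K) * (1 + A))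
  set K₂ : ℝ := C ^ 2 * (K₁ + K)
  set M : ℝ := 1 + A + K₂ * (1 + A)
  refine ⟨max M (K₂ * (1 + M ^ 2)), ?_⟩
  intro L lam γ a b c d h hEL hLC hL1 hlam hB
  have hL := h.pos
  have hΛ : 0 ≤ Λ := (abs_nonneg _).trans hlam
  have hK : 0 ≤ K := by positivity
  have hA : 0 ≤ A := by positivity
  have hK₁ : 0 ≤ K₁ := by positivity
  have hK₂ : 0 ≤ K₂ := by positivity
  have hbA := h.integral_norm_sq_two_le hC hLC hB
  obtain ⟨V, hV⟩ := h.firstIntegral_eq hEL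
  have hV1 : ‖V‖ ≤ K₁ := h.norm_firstIntegral_le hC hLC hlam hbA hV
  have hc : ∀ x ∈ J, ‖c x‖ ≤ K₂ * (1 + ‖b x‖ ^ 2) := by
    intro x hx
    have h1 : ‖(2 * L ^ 2) • c x‖ ≤ (K₁ + K) * (1 + ‖b x‖ ^ 2) := by
      rw [eq_sub_of_add_eq (hV x hx)]
      refine (norm_sub_le _ _).trans ((add_le_add hV1
        (h.norm_coeff_smul_le hC hLC hlam hx)).trans ?_)
      have : 0 ≤ K₁ * ‖b x‖ ^ 2 := by positivity
      linarith
    rw [norm_smul, Real.norm_of_nonneg (by positivity)] at h1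
    have h2 : 1 ≤ C ^ 2 * L ^ 2 := by
      rw [← mul_pow]
      exact one_le_pow₀ (by rwa [div_le_iff₀' hC] at hL1)
    calc ‖c x‖ ≤ (C ^ 2 * L ^ 2) * ‖c x‖ := le_mul_of_one_le_left (norm_nonneg _) h2
      _ ≤ C ^ 2 * (2 * L ^ 2 * ‖c x‖) := by
        have : 0 ≤ C ^ 2 * L ^ 2 * ‖c x‖ := by positivity
        linarith
      _ ≤ C ^ 2 * ((K₁ + K) * (1 + ‖b x‖ ^ 2)) := by gcongr
      _ = _ := by ring
  have hosc : ∀ x ∈ J, ∀ y ∈ J, ‖b y - b x‖ ≤ K₂ * (1 + A) := fun x hx y hy =>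
    norm_sub_le_of_norm_deriv_le_integral h.deriv₃ h.deriv₄.continuousOn
      (h.continuousOn_one_add_norm_sq K₂) hc (h.integral_one_add_norm_sq_le hK₂ hbA) hx hy
  have hb : ∀ y ∈ J, ‖b y‖ ≤ M := by
    intro y hy
    -- Bounded oscillation compares `b y` with every `b x`; averaging over `x` brings in the energy.
    have h1 : ∀ x ∈ Icc (0 : ℝ) 1, ‖b y‖ - K₂ * (1 + A) ≤ 1 * (1 + ‖b x‖ ^ 2) := by
      intro x hx
      have := (norm_sub_norm_le _ _).trans (hosc x hx y hy)
      nlinarith [sq_nonneg (‖b x‖ - 1)]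
    have h2 := intervalIntegral.integral_mono_on (μ := volume) zero_le_one intervalIntegrable_const
      ((h.continuousOn_one_add_norm_sq 1).intervalIntegrable_of_Icc zero_le_one) h1
    have h3 := h2.trans (h.integral_one_add_norm_sq_le zero_le_one hbA)
    simp only [intervalIntegral.integral_const, sub_zero, one_smul] at h3
    linarith
  intro x hx
  refine ⟨(hb x hx).trans (le_max_left _ _), (hc x hx).trans (le_trans ?_ (le_max_right _ _))⟩
  have := hb x hx
  gcongr

/-- Bootstrapping: the equation writes `d = c'` as a polynomial in `a, b, c` whose coefficients are
bounded, `L j` being bounded away from 0. Bounds of order `m` on the triple thus give bounds of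
order `m + 1`. -/
theorem uniformlyBoundedDerivs_of_solves {L lam : ℕ → ℝ} {γ a b c d : ℕ → ℝ → Space n}
    (h : ∀ j, ConstantSpeedJet (L j) (γ j) (a j) (b j) (c j) (d j))
    (hEL : ∀ j, SolvesEulerLagrange (lam j) (γ j)) {C Λ : ℝ} (hC : 0 < C)
    (hLC : ∀ j, L j ≤ C) (hL1 : ∀ j, 1 / C ≤ L j) (hlam : ∀ j, |lam j| ≤ Λ)
    (hB : ∀ j, bending (γ j) ≤ C) (m : ℕ) : UniformlyBoundedDerivs m a := by
  obtain ⟨M, hM⟩ := exists_bound_two_three (n := n) hC Λ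
  have hbM : ∀ j, ∀ x ∈ J, ‖b j x‖ ≤ M := fun j x hx =>
    (hM (h j) (hEL j) (hLC j) (hL1 j) (hlam j) (hB j) x hx).1
  have hcM : ∀ j, ∀ x ∈ J, ‖c j x‖ ≤ M := fun j x hx =>
    (hM (h j) (hEL j) (hLC j) (hL1 j) (hlam j) (hB j) x hx).2
  have haM : ∀ j, ∀ x ∈ J, ‖a j x‖ ≤ C := fun j x hx => by
    rw [(h j).speed x hx]; exact hLC j
  suffices H : UniformlyBoundedDerivs m a ∧ UniformlyBoundedDerivs m b ∧
      UniformlyBoundedDerivs m c from H.1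
  induction m with
  | zero =>
    exact ⟨⟨fun j => (h j).deriv₂.continuousOn, C, haM⟩,
      ⟨fun j => (h j).deriv₃.continuousOn, M, hbM⟩, ⟨fun j => (h j).deriv₄.continuousOn, M, hcM⟩⟩
  | succ m ih =>
    obtain ⟨ha, hb, hc⟩ := ih
    refine ⟨⟨⟨C, haM⟩, b, fun j => (h j).deriv₂, hb⟩, ⟨⟨M, hbM⟩, c, fun j => (h j).deriv₃, hc⟩,
      ⟨M, hcM⟩, d, fun j => (h j).deriv₄, ?_⟩
    have hr : UniformlyBoundedDerivs m (fun j (_ : ℝ) => -(2 * L j ^ 2)⁻¹) := by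
      refine UniformlyBoundedDerivs.const (M := (2 * (1 / C) ^ 2)⁻¹) (fun j => ?_) m
      have hL := (h j).pos
      have := hL1 j
      rw [norm_neg, Real.norm_of_nonneg (by positivity)]
      gcongr
    have hl : UniformlyBoundedDerivs m (fun j (_ : ℝ) => -(lam j * L j ^ 4)) := by
      refine UniformlyBoundedDerivs.const (M := Λ * C ^ 4) (fun j => ?_) m
      have hL := (h j).pos
      have hΛ : 0 ≤ Λ := (abs_nonneg _).trans (hlam j)
      rw [norm_neg, Real.norm_eq_abs, abs_mul, abs_of_pos (pow_pos hL 4)]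
      gcongr
      · exact hlam j
      · exact hLC j
    have h3 : UniformlyBoundedDerivs m (fun (_ : ℕ) (_ : ℝ) => (3 : ℝ)) :=
      UniformlyBoundedDerivs.const (fun _ => le_rfl) m
    have h6 : UniformlyBoundedDerivs m (fun (_ : ℕ) (_ : ℝ) => (6 : ℝ)) :=
      UniformlyBoundedDerivs.const (fun _ => le_rfl) m
    have hbb := UniformlyBoundedDerivs.bilinear (ContinuousLinearMap.mul ℝ ℝ) h3
      (UniformlyBoundedDerivs.bilinear (innerSL ℝ) hb hb)
    have hbc := UniformlyBoundedDerivs.bilinear (ContinuousLinearMap.mul ℝ ℝ) h6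
      (UniformlyBoundedDerivs.bilinear (innerSL ℝ) hb hc)
    have hs := UniformlyBoundedDerivs.bilinear (ContinuousLinearMap.lsmul ℝ ℝ) hr
      ((UniformlyBoundedDerivs.bilinear (ContinuousLinearMap.lsmul ℝ ℝ) (hbb.add hl) hb).add
        (UniformlyBoundedDerivs.bilinear (ContinuousLinearMap.lsmul ℝ ℝ) hbc ha))
    refine hs.congr fun j x hx => ?_
    have hL := (h j).pos.ne'
    have hode := ((h j).solvesEulerLagrange_iff (lam j)).1 (hEL j) x hx
    have h2 : (2 * L j ^ 2) ≠ 0 := by positivity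
    rw [add_eq_zero_iff_eq_neg, ← eq_inv_smul_iff₀ h2] at hode
    rw [hode, ← real_inner_self_eq_norm_sq]
    simp only [ContinuousLinearMap.lsmul_apply, ContinuousLinearMap.mul_apply',
      smul_neg, neg_smul, sub_eq_add_neg]
    rfl

end Bounds

/-! ### First variation: solutions of the Euler-Lagrange equation are critical. -/

section Variation

variable {n : ℕ}

/-- The directional derivative of a map of the two variables `(ε, x)`. -/
noncomputable def dirDeriv (v : ℝ × ℝ) (H : ℝ × ℝ → Space n) : ℝ × ℝ → Space n :=
  fun p => fderiv ℝ H p v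

theorem contDiff_dirDeriv {H : ℝ × ℝ → Space n} (hH : ContDiff ℝ ∞ H) (v : ℝ × ℝ) :
    ContDiff ℝ ∞ (dirDeriv v H) :=
  (hH.fderiv_right (m := ∞) (by simp)).clm_apply contDiff_const

theorem dirDeriv_comm {H : ℝ × ℝ → Space n} (hH : ContDiff ℝ ∞ H) (v w : ℝ × ℝ) :
    dirDeriv v (dirDeriv w H) = dirDeriv w (dirDeriv v H) := by
  funext p
  have hd : DifferentiableAt ℝ (fderiv ℝ H) p :=
    (hH.fderiv_right (m := ∞) (by simp)).differentiable (by simp) p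
  have h1 : ∀ v w : ℝ × ℝ, dirDeriv v (dirDeriv w H) p = fderiv ℝ (fderiv ℝ H) p v w := by
    intro v w
    have : HasFDerivAt (dirDeriv w H) ((fderiv ℝ (fderiv ℝ H) p).flip w) p := by
      have := hd.hasFDerivAt.clm_apply (hasFDerivAt_const w p)
      change HasFDerivAt (fun q => fderiv ℝ H q w) _ p
      simpa using this
    rw [dirDeriv, this.fderiv]
    rfl
  rw [h1, h1]
  refine (hH.contDiffAt.isSymmSndFDerivAt ?_).eq v w
  rw [minSmoothness_of_isRCLikeNormedField]
  exact WithTop.coe_le_coe.2 le_top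

theorem hasDerivAt_fst {H : ℝ × ℝ → Space n} (hH : ContDiff ℝ ∞ H) (ε x : ℝ) :
    HasDerivAt (fun ε => H (ε, x)) (dirDeriv (1, 0) H (ε, x)) ε :=
  ((hH.differentiable (by simp) (ε, x)).hasFDerivAt).comp_hasDerivAt ε
    ((hasDerivAt_id ε).prodMk (hasDerivAt_const ε x))

theorem hasDerivAt_snd {H : ℝ × ℝ → Space n} (hH : ContDiff ℝ ∞ H) (ε x : ℝ) :
    HasDerivAt (fun x => H (ε, x)) (dirDeriv (0, 1) H (ε, x)) x :=
  ((hH.differentiable (by simp) (ε, x)).hasFDerivAt).comp_hasDerivAt x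
    ((hasDerivAt_const x ε).prodMk (hasDerivAt_id x))

theorem dirDeriv_eq_zero {H : ℝ × ℝ → Space n} {U : Set (ℝ × ℝ)} (hU : IsOpen U)
    (hH : ∀ p ∈ U, H p = 0) (v : ℝ × ℝ) : ∀ p ∈ U, dirDeriv v H p = 0 := by
  intro p hp
  have : H =ᶠ[𝓝 p] fun _ => 0 := by
    filter_upwards [hU.mem_nhds hp] with q hq using hH q hq
  rw [dirDeriv, this.fderiv_eq]
  simp

theorem eventually_forall_norm_lt {A : ℝ × ℝ → Space n} (hA : Continuous A)
    (hA0 : ∀ x, A (0, x) = 0) {L : ℝ} (hL : 0 < L) :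
    ∀ᶠ ε in 𝓝 (0 : ℝ), ∀ x ∈ J, ‖A (ε, x)‖ < L := by
  refine isCompact_Icc.eventually_forall_of_forall_eventually fun x _ => ?_
  refine (isOpen_lt hA.norm continuous_const).mem_nhds ?_
  simpa [hA0 x] using hL

/-- Differentiation under the integral, used for both length and energy. For small `ε` the
perturbation of `p` stays below `L`, so the first argument avoids the singularity at 0; compactness
in `(ε, x)` then supplies a constant dominating function. -/
theorem hasDerivAt_integral_comp {Φ : Space n × Space n → ℝ}
    (hΦ : ContDiffOn ℝ 1 Φ {z | z.1 ≠ 0}) {p q : ℝ → Space n} {L : ℝ} (hL : 0 < L)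
    (hp : ContinuousOn p J) (hq : ContinuousOn q J) (hpL : ∀ x ∈ J, ‖p x‖ = L)
    {A B : ℝ × ℝ → Space n} (hA : ContDiff ℝ ∞ A) (hB : ContDiff ℝ ∞ B)
    (hA0 : ∀ x, A (0, x) = 0) (hB0 : ∀ x, B (0, x) = 0) :
    HasDerivAt (fun ε => ∫ x in (0 : ℝ)..1, Φ (p x + A (ε, x), q x + B (ε, x)))
      (∫ x in (0 : ℝ)..1, fderiv ℝ Φ (p x, q x)
        (dirDeriv (1, 0) A (0, x), dirDeriv (1, 0) B (0, x))) 0 := by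
  have hopen : IsOpen {z : Space n × Space n | z.1 ≠ 0} :=
    isOpen_ne_fun continuous_fst continuous_const
  obtain ⟨δ, hδ, hball⟩ := Metric.nhds_basis_closedBall.eventually_iff.1
    (eventually_forall_norm_lt hA.continuous hA0 hL)
  set S : Set ℝ := Metric.closedBall 0 δ with hS
  have hne : ∀ ε ∈ S, ∀ x ∈ J, p x + A (ε, x) ≠ 0 := by
    intro ε hε x hx h0
    have h1 := hball hε x hx
    rw [← norm_neg, ← eq_neg_of_add_eq_zero_left h0, hpL x hx] at h1
    exact lt_irrefl _ h1
  have hz : ContinuousOn (fun e : ℝ × ℝ => (p e.2 + A e, q e.2 + B e)) (S ×ˢ J) := by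
    have hp' : ContinuousOn (fun e : ℝ × ℝ => p e.2) (S ×ˢ J) :=
      hp.comp continuousOn_snd fun e he => he.2
    have hq' : ContinuousOn (fun e : ℝ × ℝ => q e.2) (S ×ˢ J) :=
      hq.comp continuousOn_snd fun e he => he.2
    exact (hp'.add hA.continuous.continuousOn).prodMk (hq'.add hB.continuous.continuousOn)
  have hmaps : MapsTo (fun e : ℝ × ℝ => (p e.2 + A e, q e.2 + B e)) (S ×ˢ J)
      {z : Space n × Space n | z.1 ≠ 0} := fun e he => hne e.1 he.1 e.2 he.2
  have hG : ContinuousOn (fun e : ℝ × ℝ => Φ (p e.2 + A e, q e.2 + B e)) (S ×ˢ J) :=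
    hΦ.continuousOn.comp hz hmaps
  have hG' : ContinuousOn (fun e : ℝ × ℝ => fderiv ℝ Φ (p e.2 + A e, q e.2 + B e)
      (dirDeriv (1, 0) A e, dirDeriv (1, 0) B e)) (S ×ˢ J) := by
    refine ((hΦ.continuousOn_fderiv_of_isOpen hopen le_rfl).comp hz hmaps).clm_apply ?_
    exact ((contDiff_dirDeriv hA _).continuous.prodMk
      (contDiff_dirDeriv hB _).continuous).continuousOn
  have hslice : ∀ ε ∈ S, ∀ {f : ℝ × ℝ → ℝ}, ContinuousOn f (S ×ˢ J) →
      IntervalIntegrable (fun x => f (ε, x)) volume 0 1 := by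
    intro ε hε f hf
    refine ContinuousOn.intervalIntegrable_of_Icc zero_le_one ?_
    exact hf.comp (by fun_prop) fun x hx => ⟨hε, hx⟩
  have h0S : (0 : ℝ) ∈ S := Metric.mem_closedBall_self hδ.le
  obtain ⟨M, hM⟩ := ((isCompact_closedBall (0 : ℝ) δ).prod
    (isCompact_Icc (a := (0 : ℝ)) (b := 1))).exists_bound_of_continuousOn hG'
  have hsub : uIoc (0 : ℝ) 1 ⊆ J := by
    rw [uIoc_of_le zero_le_one]; exact Ioc_subset_Icc_self
  have key := (intervalIntegral.hasDerivAt_integral_of_dominated_loc_of_deriv_le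
    (μ := volume) (a := 0) (b := 1) (x₀ := (0 : ℝ)) (s := S) (bound := fun _ => M)
    (F := fun ε x => Φ (p x + A (ε, x), q x + B (ε, x)))
    (F' := fun ε x => fderiv ℝ Φ (p x + A (ε, x), q x + B (ε, x))
      (dirDeriv (1, 0) A (ε, x), dirDeriv (1, 0) B (ε, x)))
    (Metric.closedBall_mem_nhds 0 hδ) ?_ (hslice 0 h0S hG)
    (hslice 0 h0S hG').def'.aestronglyMeasurable ?_ intervalIntegrable_const ?_).2
  · simpa only [hA0, hB0, add_zero] using key
  · filter_upwards [Metric.closedBall_mem_nhds 0 hδ] with ε hε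
    exact (hslice ε hε hG).def'.aestronglyMeasurable
  · exact Eventually.of_forall fun x hx ε hε => hM (ε, x) ⟨hε, hsub hx⟩
  · refine Eventually.of_forall fun x hx ε hε => ?_
    have h1 : HasFDerivAt Φ (fderiv ℝ Φ (p x + A (ε, x), q x + B (ε, x)))
        (p x + A (ε, x), q x + B (ε, x)) :=
      ((hΦ.contDiffAt (hopen.mem_nhds (hne ε hε x (hsub hx)))).differentiableAt
        (by simp)).hasFDerivAt
    exact h1.comp_hasDerivAt ε (f := fun ε => (p x + A (ε, x), q x + B (ε, x)))
      (((hasDerivAt_fst hA ε x).const_add (p x)).prodMk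
        ((hasDerivAt_fst hB ε x).const_add (q x)))

/-- The density of the bending energy as a function of the first two derivatives of a curve. -/
noncomputable def bendingDensity (z : Space n × Space n) : ℝ :=
  ‖z.2‖ ^ 2 / ‖z.1‖ ^ 3 - inner ℝ z.1 z.2 ^ 2 / ‖z.1‖ ^ 5

theorem contDiffOn_norm_fst :
    ContDiffOn ℝ 1 (fun z : Space n × Space n => ‖z.1‖) {z | z.1 ≠ 0} :=
  fun _ hz => (contDiffAt_fst.norm ℝ hz).contDiffWithinAt

theorem contDiffOn_bendingDensity :
    ContDiffOn ℝ 1 (bendingDensity (n := n)) {z | z.1 ≠ 0} := by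
  have h1 := contDiffOn_norm_fst (n := n)
  have h2 : ContDiffOn ℝ 1 (fun z : Space n × Space n => ‖z.2‖ ^ 2) {z | z.1 ≠ 0} :=
    (contDiff_snd.norm_sq ℝ).contDiffOn
  have h3 : ContDiffOn ℝ 1 (fun z : Space n × Space n => inner ℝ z.1 z.2 ^ 2) {z | z.1 ≠ 0} :=
    ((contDiff_fst.inner ℝ contDiff_snd).pow 2).contDiffOn
  exact (h2.div (h1.pow 3) fun z hz => pow_ne_zero _ (norm_ne_zero_iff.2 hz)).sub
    (h3.div (h1.pow 5) fun z hz => pow_ne_zero _ (norm_ne_zero_iff.2 hz))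

theorem hasDerivAt_line (p u : Space n) : HasDerivAt (fun t : ℝ => p + t • u) u 0 := by
  simpa using ((hasDerivAt_id (0 : ℝ)).smul_const u).const_add p

theorem hasDerivWithinAt_norm {f : ℝ → Space n} {f' : Space n} {s : Set ℝ} {x : ℝ}
    (hf : HasDerivWithinAt f f' s x) (hx : f x ≠ 0) :
    HasDerivWithinAt (fun t => ‖f t‖) (inner ℝ (f x) f' / ‖f x‖) s x := by
  have h1 := hf.norm_sq.sqrt (pow_ne_zero 2 (norm_ne_zero_iff.2 hx))
  simp only [Real.sqrt_sq (norm_nonneg _)] at h1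
  convert h1 using 1
  rw [mul_div_mul_left _ _ two_ne_zero]

theorem fderiv_apply_eq_of_hasDerivAt_line {Φ : Space n × Space n → ℝ}
    (hΦ : ContDiffOn ℝ 1 Φ {z | z.1 ≠ 0}) {p q u v : Space n} (hp : p ≠ 0) {k : ℝ}
    (hk : HasDerivAt (fun t : ℝ => Φ (p + t • u, q + t • v)) k 0) :
    fderiv ℝ Φ (p, q) (u, v) = k := by
  have hopen : IsOpen {z : Space n × Space n | z.1 ≠ 0} :=
    isOpen_ne_fun continuous_fst continuous_const
  have h1 : HasFDerivAt Φ (fderiv ℝ Φ (p, q)) (p + (0 : ℝ) • u, q + (0 : ℝ) • v) := by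
    simpa using ((hΦ.contDiffAt (hopen.mem_nhds (show (p, q).1 ≠ 0 from hp))).differentiableAt
      (by simp)).hasFDerivAt
  exact (h1.comp_hasDerivAt (0 : ℝ) ((hasDerivAt_line p u).prodMk (hasDerivAt_line q v))).unique hk

theorem fderiv_norm_fst {p q u v : Space n} (hp : p ≠ 0) :
    fderiv ℝ (fun z : Space n × Space n => ‖z.1‖) (p, q) (u, v) = inner ℝ p u / ‖p‖ := by
  refine fderiv_apply_eq_of_hasDerivAt_line contDiffOn_norm_fst hp ?_
  have := hasDerivWithinAt_norm (hasDerivAt_line p u).hasDerivWithinAt (s := univ) (by simpa using hp)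
  simpa using this

/-- The second term of the density is quadratic in `⟨p,q⟩`, so it contributes nothing to first order
when `p ⟂ q`, as holds at constant speed. -/
theorem fderiv_bendingDensity {p q u v : Space n} (hp : p ≠ 0) (hpq : inner ℝ p q = 0) :
    fderiv ℝ bendingDensity (p, q) (u, v) =
      2 * inner ℝ q v / ‖p‖ ^ 3 - 3 * ‖q‖ ^ 2 * inner ℝ p u / ‖p‖ ^ 5 := by
  refine fderiv_apply_eq_of_hasDerivAt_line contDiffOn_bendingDensity hp ?_
  have hN : HasDerivAt (fun t : ℝ => ‖p + t • u‖) (inner ℝ p u / ‖p‖) 0 := by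
    have := hasDerivWithinAt_norm (hasDerivAt_line p u).hasDerivWithinAt (s := univ)
      (by simpa using hp)
    simpa using this
  have hq := (hasDerivAt_line q v).norm_sq
  have hi := ((hasDerivAt_line p u).inner ℝ (hasDerivAt_line q v)).pow 2
  have hN0 : ‖p‖ ≠ 0 := norm_ne_zero_iff.2 hp
  have h3 := hq.div (hN.pow 3) (by simpa using hN0)
  have h5 := hi.div (hN.pow 5) (by simpa using hN0)
  refine (h3.sub h5).congr_deriv ?_
  simp [hpq]
  field_simp

/-- Perturbed curves need not have constant speed, so the energy density is required for an
arbitrary regular parametrization. -/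
theorem norm_curvature_sq_mul_speed {c P Q : ℝ → Space n} (hP : HasDerivOnJ c P)
    (hQ : HasDerivOnJ P Q) (hne : ∀ x ∈ J, P x ≠ 0) :
    ∀ x ∈ J, ‖curvature c x‖ ^ 2 * ‖dx c x‖ = bendingDensity (P x, Q x) := by
  have hdx : EqOn (dx c) P J := fun x hx => hP.derivWithin hx
  have hT : EqOn (ds c c) (fun x => ‖P x‖⁻¹ • P x) J := by
    intro x hx
    simp only [ds, hdx hx]
  have hT' : HasDerivOnJ (ds c c) (fun x => ‖P x‖⁻¹ • Q x +
      (-(inner ℝ (P x) (Q x) / ‖P x‖) / ‖P x‖ ^ 2) • P x) :=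
    HasDerivOnJ.congr (fun x hx => ((hasDerivWithinAt_norm (hQ x hx) (hne x hx)).fun_inv
      (norm_ne_zero_iff.2 (hne x hx))).smul (hQ x hx)) hT fun _ _ => rfl
  intro x hx
  have hN0 : ‖P x‖ ≠ 0 := norm_ne_zero_iff.2 (hne x hx)
  have hc : curvature c x = ‖P x‖⁻¹ • (‖P x‖⁻¹ • Q x +
      (-(inner ℝ (P x) (Q x) / ‖P x‖) / ‖P x‖ ^ 2) • P x) := by
    rw [curvature, ds, hdx hx, dx, hT'.derivWithin hx]
  rw [hdx hx, hc, ← real_inner_self_eq_norm_sq]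
  simp only [inner_smul_left, inner_smul_right, inner_add_left, inner_add_right,
    real_inner_self_eq_norm_sq, conj_trivial, real_inner_comm (P x) (Q x), bendingDensity]
  field_simp
  ring

namespace ConstantSpeedJet

variable {L : ℝ} {γ a b c d : ℝ → Space n}

theorem memW22 (h : ConstantSpeedJet L γ a b c d) (hγ : ContDiffOn ℝ 1 γ J) : MemW22 γ := by
  refine ⟨hγ, b, ?_, fun x hx => ?_⟩
  · obtain ⟨M, hM⟩ := isCompact_Icc.exists_bound_of_continuousOn h.deriv₃.continuousOn
    refine MemLp.of_bound (h.deriv₃.continuousOn.aestronglyMeasurable measurableSet_Icc) M ?_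
    filter_upwards [ae_restrict_mem measurableSet_Icc] with x hx using hM x hx
  · rw [h.deriv₂.integral_eq_sub h.deriv₃.continuousOn le_rfl hx.1 hx.2]
    simp only [dx]
    rw [h.deriv₁.derivWithin hx, h.deriv₁.derivWithin ⟨le_rfl, zero_le_one⟩]
    abel

theorem immersed (h : ConstantSpeedJet L γ a b c d) : Immersed γ := by
  intro x hx
  rw [dx, h.deriv₁.derivWithin hx, ← norm_ne_zero_iff, h.speed x hx]
  exact h.pos.ne'

theorem critical (h : ConstantSpeedJet L γ a b c d) {lam : ℝ} (hEL : SolvesEulerLagrange lam γ)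
    {η : ℝ → ℝ → Space n} (hη : IsLengthPreservingVariation γ η) :
    HasDerivAt (fun ε : ℝ => bending (fun x => γ x + η ε x)) 0 0 := by
  have hL := h.pos
  set H : ℝ × ℝ → Space n := fun p => η p.1 p.2 with hHdef
  have hH : ContDiff ℝ ∞ H := hη.smooth
  set A := dirDeriv (0, 1) H
  set B := dirDeriv (0, 1) A
  have hA : ContDiff ℝ ∞ A := contDiff_dirDeriv hH _
  have hB : ContDiff ℝ ∞ B := contDiff_dirDeriv hA _
  have hslice : ∀ {G : ℝ × ℝ → Space n}, ContDiff ℝ ∞ G → (∀ x, G (0, x) = 0) →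
      ∀ x, dirDeriv (0, 1) G (0, x) = 0 := by
    intro G hG h0 x
    have h1 := hasDerivAt_snd hG 0 x
    simp only [h0] at h1
    exact h1.unique (hasDerivAt_const x 0)
  have hA0 : ∀ x, A (0, x) = 0 := hslice hH hη.initial
  have hB0 : ∀ x, B (0, x) = 0 := hslice hA hA0
  have hane : ∀ x ∈ J, a x ≠ 0 := fun x hx => by
    rw [← norm_ne_zero_iff, h.speed x hx]; exact hL.ne'
  have hcurve : ∀ ε, HasDerivOnJ (fun x => γ x + η ε x) (fun x => a x + A (ε, x)) :=
    fun ε x hx => (h.deriv₁ x hx).add (hasDerivAt_snd hH ε x).hasDerivWithinAt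
  have hcurve' : ∀ ε, HasDerivOnJ (fun x => a x + A (ε, x)) (fun x => b x + B (ε, x)) :=
    fun ε x hx => (h.deriv₂ x hx).add (hasDerivAt_snd hA ε x).hasDerivWithinAt
  set δ : ℝ → Space n := fun x => dirDeriv (1, 0) H (0, x)
  set u : ℝ → Space n := fun x => dirDeriv (1, 0) A (0, x) with hu
  set v : ℝ → Space n := fun x => dirDeriv (1, 0) B (0, x) with hv
  -- Symmetry of mixed partials: the variation of the derivative is the derivative of the variation
  -- `δ`; likewise for `v`.
  have hδu : HasDerivOnJ δ u := by
    intro x _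
    rw [hu]
    simp only [A]
    rw [dirDeriv_comm hH]
    exact (hasDerivAt_snd (contDiff_dirDeriv hH (1, 0)) 0 x).hasDerivWithinAt
  have huv : HasDerivOnJ u v := by
    intro x _
    rw [hv]
    simp only [B]
    rw [dirDeriv_comm hA]
    exact (hasDerivAt_snd (contDiff_dirDeriv hA (1, 0)) 0 x).hasDerivWithinAt
  have hvc : ContinuousOn v J :=
    ((contDiff_dirDeriv hB (1, 0)).continuous.comp (by fun_prop)).continuousOn
  have hend : ∀ x ∉ Ioo (0 : ℝ) 1, δ x = 0 ∧ u x = 0 := by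
    intro x hx
    obtain ⟨K, hK, hKI, hη0⟩ := hη.compactSupport
    have hU : IsOpen (univ ×ˢ Kᶜ : Set (ℝ × ℝ)) := isOpen_univ.prod hK.isClosed.isOpen_compl
    have hH0 : ∀ p ∈ (univ ×ˢ Kᶜ : Set (ℝ × ℝ)), H p = 0 := fun p hp => hη0 p.1 p.2 hp.2
    have hxU : ((0 : ℝ), x) ∈ (univ ×ˢ Kᶜ : Set (ℝ × ℝ)) := ⟨mem_univ _, fun hxK => hx (hKI hxK)⟩
    exact ⟨dirDeriv_eq_zero hU hH0 _ _ hxU,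
      dirDeriv_eq_zero hU (dirDeriv_eq_zero hU hH0 _) _ _ hxU⟩
  -- The constraint to first order: the derivative of length is `L⁻¹ ∫⟨a,u⟩`, and the length is
  -- constant near `ε = 0`.
  have hlen : ∫ x in (0 : ℝ)..1, inner ℝ (a x) (u x) = 0 := by
    have h1 := hasDerivAt_integral_comp contDiffOn_norm_fst hL h.deriv₂.continuousOn
      h.deriv₃.continuousOn h.speed hA hB hA0 hB0
    have h2 : HasDerivAt (fun ε => ∫ x in (0 : ℝ)..1, ‖a x + A (ε, x)‖) 0 0 := by
      refine (hasDerivAt_const (0 : ℝ) (length γ)).congr_of_eventuallyEq ?_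
      filter_upwards [hη.length_eq] with ε hε
      rw [← hε, length]
      refine intervalIntegral.integral_congr fun x hx => ?_
      rw [uIcc_of_le zero_le_one] at hx
      simp only [dx]
      rw [(hcurve ε).derivWithin hx]
    have h3 := h1.unique h2
    have h4 : ∫ x in (0 : ℝ)..1, inner ℝ (a x) (u x) = L * ∫ x in (0 : ℝ)..1,
        fderiv ℝ (fun z : Space n × Space n => ‖z.1‖) (a x, b x) (u x, v x) := by
      rw [← intervalIntegral.integral_const_mul]
      refine intervalIntegral.integral_congr fun x hx => ?_
      rw [uIcc_of_le zero_le_one] at hx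
      rw [fderiv_norm_fst (hane x hx), h.speed x hx]
      field_simp
    rw [h4, h3, mul_zero]
  have hbend : ∫ x in (0 : ℝ)..1, fderiv ℝ bendingDensity (a x, b x) (u x, v x) = 0 := by
    obtain ⟨V, hV⟩ := h.firstIntegral_eq hEL
    have hbu := h.deriv₃.inner huv
    -- Substituting `3|b|² a = V - 2L² c + λL⁴ a` makes the varied density the derivative of this
    -- function minus `λL⁻¹⟨a,u⟩`. The function vanishes at both endpoints, and the remainder
    -- integrates to 0 by `hlen`.
    have hR : HasDerivOnJ
        (fun x => 2 * (L⁻¹) ^ 3 * inner ℝ (b x) (u x) - (L⁻¹) ^ 5 * inner ℝ V (δ x))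
        (fun x => 2 * (L⁻¹) ^ 3 * (inner ℝ (b x) (v x) + inner ℝ (c x) (u x)) -
          (L⁻¹) ^ 5 * inner ℝ V (u x)) := by
      intro x hx
      have hVδ := (hasDerivWithinAt_const x J V).inner ℝ (hδu x hx)
      simp only [inner_zero_left, add_zero] at hVδ
      exact ((hbu x hx).const_mul _).sub (hVδ.const_mul _)
    have hbc := h.deriv₃.continuousOn
    have hcc := h.deriv₄.continuousOn
    have hac := h.deriv₂.continuousOn
    have huc := huv.continuousOn
    have hR1 := hR.integral_eq_sub (by fun_prop) le_rfl zero_le_one le_rfl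
    obtain ⟨hδ0, hu0⟩ := hend 0 (by simp)
    obtain ⟨hδ1, hu1⟩ := hend 1 (by simp)
    simp only [hδ0, hu0, hδ1, hu1, inner_zero_right, mul_zero, sub_zero] at hR1
    have hint : EqOn (fun x => fderiv ℝ bendingDensity (a x, b x) (u x, v x))
        (fun x => (2 * (L⁻¹) ^ 3 * (inner ℝ (b x) (v x) + inner ℝ (c x) (u x)) -
          (L⁻¹) ^ 5 * inner ℝ V (u x)) - lam * L⁻¹ * inner ℝ (a x) (u x)) (uIcc 0 1) := by
      intro x hx
      rw [uIcc_of_le zero_le_one] at hx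
      simp only
      rw [fderiv_bendingDensity (hane x hx) (h.inner_one_two x hx), h.speed x hx, ← hV x hx]
      simp only [inner_add_left, inner_smul_left, conj_trivial]
      field_simp
      ring
    have hi1 : IntervalIntegrable (fun x => 2 * (L⁻¹) ^ 3 * (inner ℝ (b x) (v x) +
        inner ℝ (c x) (u x)) - (L⁻¹) ^ 5 * inner ℝ V (u x)) volume 0 1 :=
      ContinuousOn.intervalIntegrable_of_Icc zero_le_one (by fun_prop)
    have hi2 : IntervalIntegrable (fun x => lam * L⁻¹ * inner ℝ (a x) (u x)) volume 0 1 :=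
      ContinuousOn.intervalIntegrable_of_Icc zero_le_one (by fun_prop)
    rw [intervalIntegral.integral_congr hint, intervalIntegral.integral_sub hi1 hi2, hR1,
      intervalIntegral.integral_const_mul, hlen, mul_zero, sub_zero]
  have hderiv := hasDerivAt_integral_comp contDiffOn_bendingDensity hL h.deriv₂.continuousOn
    h.deriv₃.continuousOn h.speed hA hB hA0 hB0
  rw [hbend] at hderiv
  refine hderiv.congr_of_eventuallyEq ?_
  filter_upwards [eventually_forall_norm_lt hA.continuous hA0 hL] with ε hε
  refine intervalIntegral.integral_congr fun x hx => ?_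
  rw [uIcc_of_le zero_le_one] at hx
  refine norm_curvature_sq_mul_speed (hcurve ε) (hcurve' ε) (fun x hx h0 => ?_) x hx
  have h1 := hε x hx
  rw [← norm_neg, ← eq_neg_of_add_eq_zero_left h0, h.speed x hx] at h1
  exact lt_irrefl _ h1

/-- A curve of constant speed which solves the Euler-Lagrange equation is an elastica. -/
theorem isElastica (h : ConstantSpeedJet L γ a b c d) (hγ : ContDiffOn ℝ 1 γ J) {lam : ℝ}
    (hEL : SolvesEulerLagrange lam γ) : IsElastica γ :=
  ⟨h.memW22 hγ, h.immersed, fun _ hη => h.critical hEL hη⟩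

end ConstantSpeedJet

end Variation

/-! ### Convergence of derivatives of all orders. -/

section Convergence

variable {n : ℕ}

theorem hasDerivOnJ_iteratedDerivWithin {f : ℝ → Space n} {m : WithTop ℕ∞}
    (hf : ContDiffOn ℝ m f J) {k : ℕ} (hk : k < m) :
    HasDerivOnJ (iteratedDerivWithin k f J) (iteratedDerivWithin (k + 1) f J) := by
  intro x hx
  rw [iteratedDerivWithin_succ]
  exact (hf.differentiableOn_iteratedDerivWithin hk uniqueDiffOn_J x hx).hasDerivWithinAt

theorem constantSpeedJet_iteratedDerivWithin {γ : ℝ → Space n} {L : ℝ} (hL : 0 < L)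
    (hγ : ContDiffOn ℝ 4 γ J) (hspeed : ∀ x ∈ J, ‖dx γ x‖ = L) :
    ConstantSpeedJet L γ (iteratedDerivWithin 1 γ J) (iteratedDerivWithin 2 γ J)
      (iteratedDerivWithin 3 γ J) (iteratedDerivWithin 4 γ J) where
  pos := hL
  deriv₁ := by
    simpa using hasDerivOnJ_iteratedDerivWithin hγ (k := 0) (by norm_num)
  deriv₂ := hasDerivOnJ_iteratedDerivWithin hγ (k := 1) (by norm_num)
  deriv₃ := hasDerivOnJ_iteratedDerivWithin hγ (k := 2) (by norm_num)
  deriv₄ := hasDerivOnJ_iteratedDerivWithin hγ (k := 3) (by norm_num)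
  speed := by
    intro x hx
    rw [iteratedDerivWithin_one]
    exact hspeed x hx

/-- A uniformly convergent sequence with uniform bounds on all derivatives of positive order
converges smoothly. -/
theorem tendstoUniformlyOn_iteratedDerivWithin {γ : ℕ → ℝ → Space n} {γlim : ℝ → Space n}
    (hγ : ∀ j, ContDiffOn ℝ ∞ (γ j) J)
    (hb : ∀ k : ℕ, ∃ M, ∀ j, ∀ x ∈ J, ‖iteratedDerivWithin (k + 1) (γ j) J x‖ ≤ M)
    (h0 : TendstoUniformlyOn γ γlim atTop J) (k : ℕ) :
    TendstoUniformlyOn (fun j => iteratedDerivWithin k (γ j) J)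
      (iteratedDerivWithin k γlim J) atTop J ∧
      HasDerivOnJ (iteratedDerivWithin k γlim J) (iteratedDerivWithin (k + 1) γlim J) := by
  have hstep : ∀ k : ℕ, TendstoUniformlyOn (fun j => iteratedDerivWithin k (γ j) J)
      (iteratedDerivWithin k γlim J) atTop J →
      TendstoUniformlyOn (fun j => iteratedDerivWithin (k + 1) (γ j) J)
        (iteratedDerivWithin (k + 1) γlim J) atTop J ∧
      HasDerivOnJ (iteratedDerivWithin k γlim J) (iteratedDerivWithin (k + 1) γlim J) := by
    intro k hk
    -- Interpolation to order `k + 1` uses a bound of order `k + 2`, which is `hb` at `k + 1`.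
    obtain ⟨M, hM⟩ := hb (k + 1)
    have hlt : ∀ k : ℕ, (k : WithTop ℕ∞) < ∞ := fun k => WithTop.coe_lt_coe.2 (ENat.natCast_lt_top k)
    obtain ⟨V, hV, hderiv⟩ := exists_tendstoUniformlyOn_deriv
      (fun j => hasDerivOnJ_iteratedDerivWithin (hγ j) (hlt k))
      (fun j => hasDerivOnJ_iteratedDerivWithin (hγ j) (hlt (k + 1))) hM hk
    have hEq : EqOn V (iteratedDerivWithin (k + 1) γlim J) J := by
      intro x hx
      rw [iteratedDerivWithin_succ, hderiv.derivWithin hx]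
    exact ⟨hV.congr_right hEq, hderiv.congr (fun _ _ => rfl) hEq.symm⟩
  have hall : ∀ k : ℕ, TendstoUniformlyOn (fun j => iteratedDerivWithin k (γ j) J)
      (iteratedDerivWithin k γlim J) atTop J := by
    intro k
    induction k with
    | zero => simpa using h0
    | succ k ih => exact (hstep k ih).1
  exact ⟨hall k, (hstep k (hall k)).2⟩

end Convergence

end ElasticCurve

/-! ### Passage to the limit. -/

theorem proposition2p2 {n : ℕ} (hn : 2 ≤ n)
    (γ : ℕ → ℝ → ElasticCurve.Space n) (γlim : ℝ → ElasticCurve.Space n) (lam : ℕ → ℝ)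
    (hanalytic : ∀ j, AnalyticOn ℝ (γ j) ElasticCurve.J)
    (hspeed : ∀ j, ElasticCurve.ConstantSpeed (γ j))
    (helastica : ∀ j, ElasticCurve.IsLambdaElastica (lam j) (γ j))
    (hbounded : ElasticCurve.BoundedAssumption γ)
    (hconv : ElasticCurve.ConvergesC 1 γ γlim)
    (hlam : BddAbove (Set.range fun j => |lam j|)) :
    (∀ m : ℕ, ElasticCurve.ConvergesC m γ γlim) ∧
      ElasticCurve.IsElastica γlim ∧
      ∃ lamlim : ℝ, ElasticCurve.IsLambdaElastica lamlim γlim := by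
  open ElasticCurve in
  obtain ⟨C, hC, hCb⟩ := hbounded
  obtain ⟨Λ, hΛ⟩ := hlam
  have hlamΛ : ∀ j, |lam j| ≤ Λ := fun j => hΛ ⟨j, rfl⟩
  have hLpos : ∀ j, 0 < length (γ j) := fun j =>
    lt_of_lt_of_le (by positivity) (hCb j).2.1
  have hsm : ∀ j (m : WithTop ℕ∞), ContDiffOn ℝ m (γ j) J := fun j m =>
    (hanalytic j).contDiffOn uniqueDiffOn_J
  have hjet := fun j => constantSpeedJet_iteratedDerivWithin (hLpos j) (hsm j 4) (hspeed j)
  have hEL := fun j => (helastica j).eulerLagrange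
  have hbdd : ∀ k : ℕ, ∃ M, ∀ j, ∀ x ∈ J, ‖iteratedDerivWithin (k + 1) (γ j) J x‖ ≤ M := by
    intro k
    obtain ⟨M, hM⟩ := (uniformlyBoundedDerivs_of_solves hjet hEL hC (fun j => (hCb j).2.2)
      (fun j => (hCb j).2.1) hlamΛ (fun j => (hCb j).1) k).iteratedDerivWithin
    refine ⟨M, fun j x hx => ?_⟩
    have h1 := hM j x hx
    rwa [iteratedDerivWithin_one, ← iteratedDerivWithin_succ'] at h1
  have h0 : TendstoUniformlyOn γ γlim atTop J := by
    simpa using hconv.tendsto 0 (Nat.zero_le 1)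
  have hunif := tendstoUniformlyOn_iteratedDerivWithin (fun j => hsm j ∞) hbdd h0
  have hlimsm : ∀ m : ℕ, ContDiffOn ℝ m γlim J := fun m =>
    contDiffOn_of_differentiableOn_deriv (n := (m : ℕ∞)) fun k _ x hx =>
      ((hunif k).2 x hx).differentiableWithinAt
  have hpt : ∀ (k : ℕ), ∀ x ∈ J, Tendsto (fun j => iteratedDerivWithin k (γ j) J x) atTop
      (𝓝 (iteratedDerivWithin k γlim J x)) := fun k x hx => (hunif k).1.tendsto_at hx
  -- The speeds `length (γ j)` do not depend on `x`, so uniqueness of limits gives constant speed in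
  -- the limit.
  have hspeedlim : ∀ x ∈ J, Tendsto (fun j => length (γ j)) atTop (𝓝 ‖dx γlim x‖) := by
    intro x hx
    have h1 := (hpt 1 x hx).norm
    simp only [iteratedDerivWithin_one] at h1
    exact h1.congr fun j => hspeed j x hx
  set L : ℝ := ‖dx γlim 0‖
  have hlenlim : Tendsto (fun j => length (γ j)) atTop (𝓝 L) :=
    hspeedlim 0 ⟨le_rfl, zero_le_one⟩
  have hL : 0 < L := lt_of_lt_of_le (by positivity)
    (ge_of_tendsto' hlenlim fun j => (hCb j).2.1 : 1 / C ≤ L)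
  have hjetlim := constantSpeedJet_iteratedDerivWithin hL (hlimsm 4)
    fun x hx => tendsto_nhds_unique (hspeedlim x hx) hlenlim
  -- Only the multipliers require a subsequence; the curves already converge along the whole
  -- sequence.
  obtain ⟨l, -, φ, hφ, hl⟩ := (isCompact_Icc (a := -Λ) (b := Λ)).tendsto_subseq
    fun j => abs_le.1 (hlamΛ j)
  have hELlim : SolvesEulerLagrange l γlim := by
    rw [hjetlim.solvesEulerLagrange_iff]
    intro x hx
    have hp := fun k => (hpt k x hx).comp hφ.tendsto_atTop
    have hLs := hlenlim.comp hφ.tendsto_atTop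
    refine tendsto_nhds_unique ((((hLs.pow 2).const_mul 2).smul (hp 4)).add
      ((((((hp 2).norm.pow 2).const_mul 3).sub (hl.mul (hLs.pow 4))).smul (hp 2)).add
        ((((hp 2).inner (hp 3)).const_mul 6).smul (hp 1)))) ?_
    refine tendsto_const_nhds.congr fun j => ?_
    exact (((hjet (φ j)).solvesEulerLagrange_iff _).1 (hEL (φ j)) x hx).symm
  have hel : IsElastica γlim := hjetlim.isElastica (hlimsm 1) hELlim
  exact ⟨fun m => ⟨fun j => hsm j m, hlimsm m, fun k _ => (hunif k).1⟩, hel, l, hel, hlimsm 4,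
    hELlim⟩
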